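/- Theorem 3.6. Let $n$ be a natural number, let $A, B, X$ be complex $n\times n$ matrices with $A$ and $B$ positive definite, and let $|||\cdot|||$ be a unitarily invariant norm on the complex $n\times n$ matrices, that is, a norm with $|||UYV|||=|||Y|||$ for every matrix $Y$ and all unitary matrices $U,V$. Let $0<\nu\le\frac12$, let $r_0=\min\{2\nu,\,1-2\nu\}$, and let $m\ge 1$ be an integer. Then $$\begin{aligned}\bigl((1-\nu)|||AX|||+\nu|||XB|||\bigr)^m \ \ge\ {}& |||A^{1-\nu}XB^{\nu}|||^m+\nu^m\bigl(|||AX|||+|||XB|||\bigr)^m\\ &-\Bigl(2\nu\,(|||AX|||\,|||XB|||)^{1/2}-r_0\bigl((|||AX|||\,|||XB|||)^{1/4}-|||AX|||^{1/2}\bigr)^2\Bigr)^m .\end{aligned}$$ Here $A^{1-\nu}$ and $B^{\nu}$ are the real powers given by the functional calculus for positive definite matrices. -/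

import Mathlib

open scoped ComplexOrder MatrixOrder

/-- A unitarily invariant norm on the complex `n × n` matrices: a seminorm over `ℂ` that vanishes
only at `0` (so a norm) and satisfies `N (U * A * V) = N A` for all unitary `U`, `V`. -/
structure IsUnitarilyInvariantNorm {n : ℕ} (N : Seminorm ℂ (Matrix (Fin n) (Fin n) ℂ)) :
    Prop where
  eq_zero_of_map_eq_zero : ∀ A : Matrix (Fin n) (Fin n) ℂ, N A = 0 → A = 0
  map_unitary_mul_mul : ∀ U ∈ Matrix.unitaryGroup (Fin n) ℂ,
    ∀ V ∈ Matrix.unitaryGroup (Fin n) ℂ, ∀ A : Matrix (Fin n) (Fin n) ℂ, N (U * A * V) = N A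

/-!
The norm inequality is a three lines argument. With `h = log a` and `k = log b`, the entire function
`f z = exp ((1 - z) h) x exp (z k)` satisfies `f 0 = a x`, `f θ = a ^ (1 - θ) x b ^ θ` and
`f 1 = x b`. Changing the imaginary part of `z` multiplies `f z` by unitaries on both sides, so a
unitarily invariant seminorm of `f z` depends only on `re z`, and Hadamard's theorem gives
`|||a ^ (1 - θ) x b ^ θ||| ≤ |||a x||| ^ (1 - θ) |||x b||| ^ θ`.

It remains to prove a scalar inequality for `s = |||a x|||` and `t = |||x b|||`. The refined Young
inequality for `s` and `√(s t)` with weight `2ν` reads `G + Q ≤ P + S`, where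
`G = s ^ (1 - ν) t ^ ν`, `Q = ν (s + t)`, `P = (1 - ν) s + ν t` and `S` is the base of the
subtracted power. Since `S ≤ Q ≤ P`, it survives raising every term to the power `m`: by convexity
if `S ≥ 0`, and by superadditivity of the power if `S < 0`.
-/

section PowerSums

variable {R : Type*} [CommRing R] [LinearOrder R] [IsStrictOrderedRing R] {a b c d : R}

theorem pow_add_pow_le_pow_add_pow_of_nonneg (ha : 0 ≤ a) (hd : 0 ≤ d) (hdb : d ≤ b) (hbc : b ≤ c)
    (h : a + b ≤ c + d) (m : ℕ) : a ^ m + b ^ m ≤ c ^ m + d ^ m := by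
  have hb : 0 ≤ b := hd.trans hdb
  rcases le_total a d with had | hda
  · rw [add_comm]
    gcongr
  · have hac : a ≤ c := by linarith
    have hc : 0 ≤ c := hb.trans hbc
    have hdiff : a ^ m - d ^ m ≤ c ^ m - b ^ m := by
      rw [← (Commute.all a d).geom_sum₂_mul, ← (Commute.all c b).geom_sum₂_mul]
      have hsub : a - d ≤ c - b := by linarith
      gcongr
    linarith

theorem pow_add_pow_le_pow_add_pow_of_nonpos (ha : 0 ≤ a) (hb : 0 ≤ b) (hd : d ≤ 0)
    (h : a + b ≤ c + d) (m : ℕ) : a ^ m + b ^ m ≤ c ^ m + d ^ m := by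
  rcases eq_or_ne m 0 with rfl | hm
  · simp
  have hneg : 0 ≤ -d := neg_nonneg.2 hd
  have habs : -d ^ m ≤ (-d) ^ m := by
    simpa [abs_of_nonpos hd] using neg_le_abs (d ^ m)
  have hsuper : a ^ m + b ^ m + (-d) ^ m ≤ (a + b + -d) ^ m :=
    calc a ^ m + b ^ m + (-d) ^ m ≤ (a + b) ^ m + (-d) ^ m := by
          gcongr
          exact pow_add_pow_le ha hb hm
      _ ≤ (a + b + -d) ^ m := pow_add_pow_le (add_nonneg ha hb) hneg hm
  have hmono : (a + b + -d) ^ m ≤ c ^ m := by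
    gcongr
    linarith
  linarith

theorem pow_add_pow_le_pow_add_pow (ha : 0 ≤ a) (hb : 0 ≤ b) (hdb : d ≤ b) (hbc : b ≤ c)
    (h : a + b ≤ c + d) (m : ℕ) : a ^ m + b ^ m ≤ c ^ m + d ^ m := by
  rcases le_total 0 d with hd | hd
  · exact pow_add_pow_le_pow_add_pow_of_nonneg ha hd hdb hbc h m
  · exact pow_add_pow_le_pow_add_pow_of_nonpos ha hb hd h m

end PowerSums

section RefinedYoung

variable {x y μ : ℝ}

theorem rpow_one_sub_two_mul_mul_sqrt_mul_rpow (hx : 0 ≤ x) (hy : 0 ≤ y) (hμ₀ : 0 ≤ μ)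
    (hμ₁ : μ ≤ 1 / 2) :
    x ^ (1 - 2 * μ) * √(x * y) ^ (2 * μ) = x ^ (1 - μ) * y ^ μ := by
  rw [Real.rpow_mul (Real.sqrt_nonneg _), Real.rpow_two, Real.sq_sqrt (by positivity),
    Real.mul_rpow hx hy, ← mul_assoc, ← Real.rpow_add_of_nonneg hx (by linarith) hμ₀]
  ring_nf

theorem rpow_mul_rpow_add_mul_sq_le_of_le_half (hx : 0 ≤ x) (hy : 0 ≤ y) (hμ₀ : 0 ≤ μ)
    (hμ₁ : μ ≤ 1 / 2) :
    x ^ (1 - μ) * y ^ μ + μ * (√y - √x) ^ 2 ≤ (1 - μ) * x + μ * y := by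
  have hyoung : x ^ (1 - μ) * y ^ μ ≤ (1 - 2 * μ) * x + 2 * μ * √(x * y) := by
    rw [← rpow_one_sub_two_mul_mul_sqrt_mul_rpow hx hy hμ₀ hμ₁]
    exact Real.geom_mean_le_arith_mean2_weighted (by linarith) (by linarith) hx
      (Real.sqrt_nonneg _) (by ring)
  calc x ^ (1 - μ) * y ^ μ + μ * (√y - √x) ^ 2
      ≤ (1 - 2 * μ) * x + 2 * μ * √(x * y) + μ * (√y - √x) ^ 2 := by gcongr
    _ = (1 - μ) * x + μ * y := by
      rw [Real.sqrt_mul hx, sub_sq, Real.sq_sqrt hx, Real.sq_sqrt hy]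
      ring

/-- Kittaneh and Manasrah's refinement of Young's inequality. -/
theorem rpow_mul_rpow_add_min_mul_sq_le (hx : 0 ≤ x) (hy : 0 ≤ y) (hμ₀ : 0 ≤ μ) (hμ₁ : μ ≤ 1) :
    x ^ (1 - μ) * y ^ μ + min μ (1 - μ) * (√y - √x) ^ 2 ≤ (1 - μ) * x + μ * y := by
  rcases le_total μ (1 - μ) with hμ | hμ
  · rw [min_eq_left hμ]
    exact rpow_mul_rpow_add_mul_sq_le_of_le_half hx hy hμ₀ (by linarith)
  · rw [min_eq_right hμ]
    have hswap := rpow_mul_rpow_add_mul_sq_le_of_le_half hy hx (sub_nonneg.2 hμ₁) (by linarith)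
    rw [sub_sub_cancel] at hswap
    linarith

theorem rpow_mul_rpow_pow_add_mul_add_pow_le {s t ν : ℝ} (hs : 0 ≤ s) (ht : 0 ≤ t) (hν₀ : 0 ≤ ν)
    (hν₁ : ν ≤ 1 / 2) (m : ℕ) :
    (s ^ (1 - ν) * t ^ ν) ^ m + ν ^ m * (s + t) ^ m ≤
      ((1 - ν) * s + ν * t) ^ m +
        (2 * ν * (s * t) ^ (1 / 2 : ℝ) - min (2 * ν) (1 - 2 * ν) *
          ((s * t) ^ (1 / 4 : ℝ) - s ^ (1 / 2 : ℝ)) ^ 2) ^ m := by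
  have hroot : (s * t) ^ (1 / 4 : ℝ) = √√(s * t) := by
    rw [Real.sqrt_eq_rpow, Real.sqrt_eq_rpow, ← Real.rpow_mul (by positivity)]
    norm_num
  rw [hroot, ← Real.sqrt_eq_rpow, ← Real.sqrt_eq_rpow, ← mul_pow]
  have hyoung := rpow_mul_rpow_add_min_mul_sq_le (μ := 2 * ν) hs (Real.sqrt_nonneg (s * t))
    (by linarith) (by linarith)
  rw [rpow_one_sub_two_mul_mul_sqrt_mul_rpow hs ht hν₀ hν₁] at hyoung
  have hmin : 0 ≤ min (2 * ν) (1 - 2 * ν) := le_min (by linarith) (by linarith)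
  have hamgm : 2 * √(s * t) ≤ s + t := by
    rw [Real.sqrt_mul hs]
    linarith [two_mul_le_add_sq (√s) (√t), Real.sq_sqrt hs, Real.sq_sqrt ht]
  refine pow_add_pow_le_pow_add_pow (by positivity) (by positivity) ?_ ?_ (by linarith) m
  · calc _ ≤ ν * (2 * √(s * t)) := by
          linarith [mul_nonneg hmin (sq_nonneg (√√(s * t) - √s))]
      _ ≤ ν * (s + t) := by gcongr
  · rw [mul_add]
    gcongr
    linarith

end RefinedYoung

theorem continuous_seminorm_of_finiteDimensional {E : Type*} [NormedAddCommGroup E]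
    [NormedSpace ℝ E] [FiniteDimensional ℝ E] (p : Seminorm ℝ E) : Continuous p :=
  p.convexOn.locallyLipschitz.continuous

section ThreeLines

open Complex.HadamardThreeLines

theorem exists_dual_le_seminorm_apply_eq {𝕜 E : Type*} [RCLike 𝕜] [AddCommGroup E] [Module 𝕜 E]
    (p : Seminorm 𝕜 E) (x : E) : ∃ φ : Module.Dual 𝕜 E, (∀ y, ‖φ y‖ ≤ p y) ∧ φ x = p x := by
  let := p.toAddGroupSeminorm.toSeminormedAddCommGroup
  let : NormedSpace 𝕜 E := ⟨fun c y ↦ (map_smul_eq_mul p c y).le⟩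
  obtain ⟨φ, hφ, hφx⟩ := exists_dual_vector'' 𝕜 x
  exact ⟨φ, fun y ↦ (φ.le_of_opNorm_le hφ y).trans_eq (one_mul _), hφx⟩

theorem seminorm_le_interp_of_mem_verticalClosedStrip {E : Type*} [NormedAddCommGroup E]
    [NormedSpace ℂ E] {p : Seminorm ℂ E} (hp : Continuous p) {f : ℂ → E} {z : ℂ} {α β : ℝ}
    (hz : z ∈ verticalClosedStrip 0 1) (hf : DiffContOnCl ℂ f (verticalStrip 0 1))
    (hbdd : BddAbove ((p ∘ f) '' verticalClosedStrip 0 1))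
    (hα : ∀ w : ℂ, w.re = 0 → p (f w) ≤ α) (hβ : ∀ w : ℂ, w.re = 1 → p (f w) ≤ β) :
    p (f z) ≤ α ^ (1 - z.re) * β ^ z.re := by
  obtain ⟨φ, hφ, hφz⟩ := exists_dual_le_seminorm_apply_eq p (f z)
  have hφ_cont : Continuous φ :=
    continuous_of_continuousAt_zero φ <| by
      simpa [ContinuousAt] using squeeze_zero_norm hφ (hp.tendsto' 0 0 (map_zero p))
  let Φ : StrongDual ℂ E := ⟨φ, hφ_cont⟩
  have hΦ_bdd : BddAbove ((norm ∘ (Φ ∘ f)) '' verticalClosedStrip 0 1) := by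
    obtain ⟨M, hM⟩ := hbdd
    refine ⟨M, ?_⟩
    rintro _ ⟨w, hw, rfl⟩
    exact (hφ (f w)).trans (hM ⟨w, hw, rfl⟩)
  calc p (f z) = ‖Φ (f z)‖ := by simp [Φ, hφz, abs_of_nonneg (apply_nonneg p _)]
    _ ≤ α ^ (1 - z.re) * β ^ z.re :=
      norm_le_interp_of_mem_verticalClosedStrip₀₁' (Φ ∘ f) hz
        (Φ.differentiable.comp_diffContOnCl hf) hΦ_bdd
        (fun w hw ↦ (hφ _).trans (hα w hw)) (fun w hw ↦ (hφ _).trans (hβ w hw))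

end ThreeLines

section Exponential

open NormedSpace

variable {𝔸 : Type*} [NormedRing 𝔸] [NormedAlgebra ℂ 𝔸] [CompleteSpace 𝔸]

theorem exp_add_smul (h : 𝔸) (z w : ℂ) : exp ((z + w) • h) = exp (z • h) * exp (w • h) := by
  let +nondep : NormedAlgebra ℚ 𝔸 := .restrictScalars ℚ ℂ 𝔸
  rw [add_smul, exp_add_of_commute (((Commute.refl h).smul_left z).smul_right w)]

theorem exp_smul_mem_unitary [StarRing 𝔸] [ContinuousStar 𝔸] [StarModule ℂ 𝔸] {h : 𝔸}
    (hh : IsSelfAdjoint h) {z : ℂ} (hz : z.re = 0) : exp (z • h) ∈ unitary 𝔸 := by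
  let +nondep : NormedAlgebra ℚ 𝔸 := .restrictScalars ℚ ℂ 𝔸
  exact exp_mem_unitary_of_mem_skewAdjoint <| hh.smul_mem_skewAdjoint <| by
    simp [skewAdjoint.mem_iff, Complex.ext_iff, hz]

end Exponential

section UnitarilyInvariant

open NormedSpace Complex.HadamardThreeLines

variable {𝒜 : Type*} [CStarAlgebra 𝒜]

theorem rpow_eq_exp_smul_log [PartialOrder 𝒜] [StarOrderedRing 𝒜] {a : 𝒜}
    (ha : IsStrictlyPositive a) (s : ℝ) : a ^ s = exp (s • CFC.log a) := by
  have hpos : ∀ t ∈ spectrum ℝ a, 0 < t := by grind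
  have hlog : ContinuousOn Real.log (spectrum ℝ a) :=
    Real.continuousOn_log.mono fun t ht ↦ (hpos t ht).ne'
  rw [CFC.rpow_eq_cfc_real, ← CFC.real_exp_eq_normedSpace_exp, CFC.log, ← cfc_smul s _ a hlog,
    ← cfc_comp' Real.exp (fun t ↦ s • Real.log t) a (hf := hlog.const_smul s)]
  refine cfc_congr fun t ht ↦ ?_
  rw [Real.rpow_def_of_pos (hpos t ht), mul_comm, smul_eq_mul]

/-- Two-sided unitary invariance of a seminorm on a C⋆-algebra, the hypothesis on `|||·|||`.
Definiteness is left out, so that seminorms pulled back from quotients are covered. -/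
def IsUnitarilyInvariant (p : Seminorm ℂ 𝒜) : Prop :=
  ∀ u ∈ unitary 𝒜, ∀ v ∈ unitary 𝒜, ∀ x, p (u * x * v) = p x

variable {p : Seminorm ℂ 𝒜}

theorem IsUnitarilyInvariant.apply_exp_smul_mul_mul_exp_smul (hinv : IsUnitarilyInvariant p)
    {h k : 𝒜} (hh : IsSelfAdjoint h) (hk : IsSelfAdjoint k) (x : 𝒜) (z w : ℂ) :
    p (exp (z • h) * x * exp (w • k)) =
      p (exp (z.re • h) * x * exp (w.re • k)) := by
  have hz : exp (z • h) = exp ((z.im * Complex.I) • h) * exp (z.re • h) := by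
    rw [← Complex.coe_smul, ← exp_add_smul, add_comm, Complex.re_add_im]
  have hw : exp (w • k) = exp (w.re • k) * exp ((w.im * Complex.I) • k) := by
    rw [← Complex.coe_smul, ← exp_add_smul, Complex.re_add_im]
  rw [hz, hw, ← hinv _ (exp_smul_mem_unitary hh (z := z.im * Complex.I) (by simp)) _
    (exp_smul_mem_unitary hk (z := w.im * Complex.I) (by simp)) (exp (z.re • h) * x * _)]
  simp only [mul_assoc]

theorem IsUnitarilyInvariant.apply_exp_smul_mul_mul_exp_smul_le_interp
    (hinv : IsUnitarilyInvariant p) (hp : Continuous p) {h k : 𝒜} (hh : IsSelfAdjoint h)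
    (hk : IsSelfAdjoint k) (x : 𝒜) {θ : ℝ} (hθ₀ : 0 ≤ θ) (hθ₁ : θ ≤ 1) :
    p (exp ((1 - θ) • h) * x * exp (θ • k)) ≤ p (exp h * x) ^ (1 - θ) * p (x * exp k) ^ θ := by
  let f : ℂ → 𝒜 := fun z ↦ exp ((1 - z) • h) * x * exp (z • k)
  have hf : Differentiable ℂ f :=
    (((differentiable_exp_smul_const ℂ h).comp (differentiable_id.const_sub 1)).mul_const x).mul
      (differentiable_exp_smul_const ℂ k)
  have hre (z : ℂ) : p (f z) = p (exp ((1 - z.re) • h) * x * exp (z.re • k)) := by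
    simpa using hinv.apply_exp_smul_mul_mul_exp_smul hh hk x (1 - z) z
  have hre' (z : ℂ) : p (f z) = p (f z.re) := by simp only [hre, Complex.ofReal_re]
  have hbdd : BddAbove ((p ∘ f) '' verticalClosedStrip 0 1) := by
    have hcont : Continuous fun t : ℝ ↦ p (f t) :=
      hp.comp (hf.continuous.comp Complex.continuous_ofReal)
    refine ((isCompact_Icc (a := 0) (b := 1)).bddAbove_image hcont.continuousOn).mono ?_
    rintro _ ⟨z, hz, rfl⟩
    exact ⟨z.re, hz, (hre' z).symm⟩
  have hinterp := seminorm_le_interp_of_mem_verticalClosedStrip hp (z := θ)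
    (by simp [verticalClosedStrip, hθ₀, hθ₁]) hf.diffContOnCl hbdd
    (α := p (exp h * x)) (β := p (x * exp k))
    (fun w hw ↦ by simp [hre, hw]) (fun w hw ↦ by simp [hre, hw])
  simpa only [hre, Complex.ofReal_re] using hinterp

theorem IsUnitarilyInvariant.apply_rpow_mul_mul_rpow_le_interp [PartialOrder 𝒜]
    [StarOrderedRing 𝒜] (hinv : IsUnitarilyInvariant p) (hp : Continuous p)
    {a b : 𝒜} (ha : IsStrictlyPositive a) (hb : IsStrictlyPositive b) (x : 𝒜)
    {θ : ℝ} (hθ₀ : 0 ≤ θ) (hθ₁ : θ ≤ 1) :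
    p (a ^ (1 - θ) * x * b ^ θ) ≤ p (a * x) ^ (1 - θ) * p (x * b) ^ θ := by
  have h := hinv.apply_exp_smul_mul_mul_exp_smul_le_interp hp (.log (a := a)) (.log (a := b)) x
    hθ₀ hθ₁
  rwa [← rpow_eq_exp_smul_log ha, ← rpow_eq_exp_smul_log hb, CFC.exp_log a, CFC.exp_log b] at h

theorem theorem3p6_general [PartialOrder 𝒜] [StarOrderedRing 𝒜]
    (hinv : IsUnitarilyInvariant p) (hp : Continuous p)
    {a b : 𝒜} (ha : IsStrictlyPositive a) (hb : IsStrictlyPositive b) (x : 𝒜)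
    {ν : ℝ} (hν₀ : 0 ≤ ν) (hν₁ : ν ≤ 1 / 2) (m : ℕ) :
    p (a ^ (1 - ν) * x * b ^ ν) ^ m + ν ^ m * (p (a * x) + p (x * b)) ^ m
        - (2 * ν * (p (a * x) * p (x * b)) ^ (1 / 2 : ℝ)
            - min (2 * ν) (1 - 2 * ν) *
              ((p (a * x) * p (x * b)) ^ (1 / 4 : ℝ) - p (a * x) ^ (1 / 2 : ℝ)) ^ 2) ^ m
      ≤ ((1 - ν) * p (a * x) + ν * p (x * b)) ^ m := by
  have hinterp := hinv.apply_rpow_mul_mul_rpow_le_interp hp ha hb x hν₀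
    (hν₁.trans one_half_lt_one.le)
  have hscalar := rpow_mul_rpow_pow_add_mul_add_pow_le (apply_nonneg p (a * x))
    (apply_nonneg p (x * b)) hν₀ hν₁ m
  rw [sub_le_iff_le_add]
  refine le_trans ?_ hscalar
  gcongr

end UnitarilyInvariant

theorem theorem3p6 {n : ℕ} (N : Seminorm ℂ (Matrix (Fin n) (Fin n) ℂ))
    (hN : IsUnitarilyInvariantNorm N) (A B X : Matrix (Fin n) (Fin n) ℂ)
    (hA : A.PosDef) (hB : B.PosDef) (ν : ℝ) (hν₀ : 0 < ν) (hν₁ : ν ≤ 1 / 2)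
    (m : ℕ) (hm : 1 ≤ m) (r₀ : ℝ) (hr₀ : r₀ = min (2 * ν) (1 - 2 * ν)) :
    N (CFC.rpow A (1 - ν) * X * CFC.rpow B ν) ^ m + ν ^ m * (N (A * X) + N (X * B)) ^ m
        - (2 * ν * (N (A * X) * N (X * B)) ^ (1 / 2 : ℝ)
            - r₀ * ((N (A * X) * N (X * B)) ^ (1 / 4 : ℝ) - N (A * X) ^ (1 / 2 : ℝ)) ^ 2) ^ m
      ≤ ((1 - ν) * N (A * X) + ν * N (X * B)) ^ m := by
  subst hr₀
  open scoped Matrix.Norms.L2Operator in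
  exact theorem3p6_general hN.map_unitary_mul_mul
    (continuous_seminorm_of_finiteDimensional (N.restrictScalars ℝ))
    hA.isStrictlyPositive hB.isStrictlyPositive X hν₀.le hν₁ m
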